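/- **Setting.** Let $G=(N,E)$ be a finite graph whose nodes are distinct points of the Euclidean plane and whose edges are drawn as straight segments. $G$ need not be connected. The embedding is planar: no edge passes through a node other than its ends, and two different edges meet at most in a common end. Let $s\in N$ be the source and $D\subseteq N$ the set of targets, with $s\notin D$. Let $T$ be a Euclidean minimum Steiner tree of $D\cup\{s\}$, i.e. a geometric tree with straight edges, containing these points as vertices and possibly additional virtual nodes, of minimum total length among the finite connected geometric graphs that contain them. For a node $n$ and neighbours $c,d$ of $n$, call $d$ *next-left* after $c$ (and $c$ *next-right* after $d$) if $d$ is the next neighbour of $n$ counter-clockwise after $c$; then $(c,d)$ is an *angle* of $n$ (if $c$ is the only neighbour of $n$, the only angle is $(c,c)$). The angle *intersects* $T$ if at least one of the closed segments $nc$, $nd$ meets $T$. **Algorithm MCFR.** A message $L$ (left-hand rule) or $R$ (right-hand rule) carries only its direction, $s$, $D$, $T$, its immediate sender and its immediate receiver; thus its size does not depend on the network. A node knows only its own coordinates, those of its neighbours, and its send queue; it stores nothing else. To *inject* a pair into the angle $(c,d)$ of $n$ means to add to the send queue of $n$ an $R$ message to $c$ and an $L$ message to $d$. Initially all send queues are empty,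 except that $s$ has injected a pair into each of its angles that intersects $T$. When $n$ receives from $a$ a message $m$: - if the send queue of $n$ contains the mate of $m$ (the message of opposite direction from $n$ to $a$), then both are destroyed, and nothing else happens; - otherwise, $n$ delivers the message if $n\in D$; it adds to its send queue the message of the same direction to $b$, where $b$ is next-left after $a$ if $m$ is an $L$ message and next-right after $a$ if $m$ is an $R$ message; and, if the angle of $n$ between $a$ and $b$ that $m$ passes ($(a,b)$ for $L$, $(b,a)$ for $R$) intersects $T$, then $n$ injects a pair into every other angle of $n$ that intersects $T$. In one atomic step, a node takes any one message from its send queue and transmits it to its receiver, a neighbour, which processes it as above. A *computation* is a finite or infinite sequence of steps from the initial state. It is *fair* if every message that is in a send queue is eventually transmitted or removed from that queue. **Theorem.** Every fair computation of MCFR is finite, and in every fair computation the message is delivered to every target $t\in D$ that is connected to $s$ by a path in $G$. -/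

import Mathlib

namespace MCFR

noncomputable section

open scoped Classical

/-! ### Wireless networks embedded in the plane -/

/-- A finite wireless network. Nodes have unique coordinates, so a node is identified with its
point of the Euclidean plane `ℂ`. Neighbours are joined by an undirected edge, which is drawn as
the straight segment between them. -/
structure Network where
  /-- the nodes of the network -/
  nodes : Finset ℂ
  /-- the neighbour relation -/
  graph : SimpleGraph ℂ
  /-- only nodes of the network have neighbours -/
  mem_nodes : ∀ {u v : ℂ}, graph.Adj u v → u ∈ nodes

/-- The coordinates of the neighbours of a node. -/
def Network.neighbors (G : Network) (u : ℂ) : Finset ℂ :=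
  G.nodes.filter (fun v => G.graph.Adj u v)

/-- The embedding is planar: no edge passes through a node that is not one of its ends, and two
different edges meet at most in a common end. -/
def Network.IsPlanar (G : Network) : Prop :=
  (∀ u v w : ℂ, G.graph.Adj u v → w ∈ G.nodes → w ∈ segment ℝ u v → w = u ∨ w = v) ∧
  (∀ u v w x : ℂ, G.graph.Adj u v → G.graph.Adj w x → s(u, v) ≠ s(w, x) →
    segment ℝ u v ∩ segment ℝ w x ⊆ ({u, v} ∩ {w, x} : Set ℂ))

/-! ### Euclidean Steiner trees -/

/-- A geometric graph with `k` distinct points of the plane as its vertices and straight edges. -/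
structure PlaneGraph (k : ℕ) where
  /-- the coordinates of the vertices -/
  point : Fin k ↪ ℂ
  /-- the edges -/
  graph : SimpleGraph (Fin k)

/-- The total length of the edges (each edge is counted once). -/
def PlaneGraph.length {k : ℕ} (T : PlaneGraph k) : ℝ :=
  ∑ i : Fin k, ∑ j : Fin k, if i < j ∧ T.graph.Adj i j then dist (T.point i) (T.point j) else 0

/-- The points of the plane that are covered by the vertices and edges. -/
def PlaneGraph.carrier {k : ℕ} (T : PlaneGraph k) : Set ℂ :=
  {x | (∃ i, x = T.point i) ∨
    ∃ i j, T.graph.Adj i j ∧ x ∈ segment ℝ (T.point i) (T.point j)}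

/-- The geometric graph connects the points of the set `A`; its other vertices are virtual. -/
def PlaneGraph.Connects {k : ℕ} (T : PlaneGraph k) (A : Finset ℂ) : Prop :=
  T.graph.Connected ∧ ∀ a ∈ A, ∃ i, T.point i = a

/-- A Euclidean minimum Steiner tree of `A`: a tree that connects `A`, possibly with added virtual
nodes, of minimum total length among all finite geometric graphs that do. -/
def PlaneGraph.IsSteinerTree {k : ℕ} (T : PlaneGraph k) (A : Finset ℂ) : Prop :=
  T.graph.IsTree ∧ T.Connects A ∧
    ∀ (l : ℕ) (T' : PlaneGraph l), T'.Connects A → T.length ≤ T'.length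

/-! ### Angles at a node, computed from the coordinates `S` of its neighbours -/

/-- The counter-clockwise angle at `u` from the ray `uv` to the ray `uw`, in `(0, 2π]`. A full turn,
not the zero angle, leads from a ray to itself. -/
def ccwAngle (u v w : ℂ) : ℝ :=
  toIocMod Real.two_pi_pos 0 (Complex.arg ((w - u) / (v - u)))

/-- Node `w` is the next neighbour of `u` after `v`, counter-clockwise. If `v` is the only
neighbour, then it is its own successor. -/
def IsNextLeft (S : Finset ℂ) (u v w : ℂ) : Prop :=
  v ∈ S ∧ w ∈ S ∧ ∀ x ∈ S, ccwAngle u v w ≤ ccwAngle u v x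

/-- Node `w` is the next neighbour of `u` after `v`, clockwise. -/
def IsNextRight (S : Finset ℂ) (u v w : ℂ) : Prop :=
  v ∈ S ∧ w ∈ S ∧ ∀ x ∈ S, ccwAngle u w v ≤ ccwAngle u x v

theorem exists_isNextLeft {S : Finset ℂ} {v : ℂ} (u : ℂ) (hv : v ∈ S) :
    ∃ w, IsNextLeft S u v w := by
  obtain ⟨w, hw, h⟩ := S.exists_min_image (fun x => ccwAngle u v x) ⟨v, hv⟩
  exact ⟨w, hv, hw, h⟩

theorem exists_isNextRight {S : Finset ℂ} {v : ℂ} (u : ℂ) (hv : v ∈ S) :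
    ∃ w, IsNextRight S u v w := by
  obtain ⟨w, hw, h⟩ := S.exists_min_image (fun x => ccwAngle u x v) ⟨v, hv⟩
  exact ⟨w, hv, hw, h⟩

/-- The next-left neighbour of `u` after the neighbour `v`. -/
def nextLeft (S : Finset ℂ) (u v : ℂ) : ℂ := Classical.epsilon (IsNextLeft S u v)

/-- The next-right neighbour of `u` after the neighbour `v`. -/
def nextRight (S : Finset ℂ) (u v : ℂ) : ℂ := Classical.epsilon (IsNextRight S u v)

/-- The angles at the node `n`. The pair `(c, d)` is the angle `∠ c n d` in which `d` is next-left
after `c`, so a node with two neighbours has two angles, and a node with a single neighbour `c` has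
the one angle `(c, c)`. -/
def angles (S : Finset ℂ) (n : ℂ) : Finset (ℂ × ℂ) :=
  (S ×ˢ S).filter (fun p => IsNextLeft S n p.1 p.2)

/-- The angle `p` at `n` intersects the geometric graph `T`: one of the two edges of the angle
(segments, not rays) meets `T`. -/
def AngleIntersects {k : ℕ} (T : PlaneGraph k) (n : ℂ) (p : ℂ × ℂ) : Prop :=
  (segment ℝ n p.1 ∩ T.carrier).Nonempty ∨ (segment ℝ n p.2 ∩ T.carrier).Nonempty

/-! ### Messages -/

/-- Left-hand-rule or right-hand-rule traversal. -/
inductive Direction where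
  | left
  | right

/-- The opposite traversal direction. -/
def Direction.opp : Direction → Direction
  | .left => .right
  | .right => .left

/-- The routing information that is the same in all messages of one multicast: the source, the
targets and a tree with `k` vertices. -/
structure Header (k : ℕ) where
  source : ℂ
  targets : Finset ℂ
  tree : PlaneGraph k

/-- A message: traversal direction, header, immediate sender, immediate receiver. -/
structure Message (k : ℕ) where
  dir : Direction
  header : Header k
  sender : ℂ
  receiver : ℂ

/-- The mate of a message, at the receiver of that message: the opposite direction, with sender and
receiver exchanged. -/
def Message.mate {k : ℕ} (m : Message k) : Message k where
  dir := m.dir.opp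
  header := m.header
  sender := m.receiver
  receiver := m.sender

/-! ### The algorithm, as a local program of stateless nodes -/

/-- The pair of mates that node `n` injects into the angle `p = (c, d)` at `n`: a right-hand-rule
message to `c` and a left-hand-rule message to `d`. -/
def inject {k : ℕ} (h : Header k) (n : ℂ) (p : ℂ × ℂ) : Multiset (Message k) :=
  {⟨.right, h, n, p.1⟩, ⟨.left, h, n, p.2⟩}

/-- What the source puts into its send queue: a pair of mates for each of its angles that
intersects the tree. -/
def start {k : ℕ} (S : Finset ℂ) (h : Header k) : Multiset (Message k) :=
  ∑ p ∈ (angles S h.source).filter (AngleIntersects h.tree h.source), inject h h.source p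

/-- The neighbour to which `n` forwards a message that has come from `a`. -/
def nextHop (S : Finset ℂ) (n a : ℂ) : Direction → ℂ
  | .left => nextLeft S n a
  | .right => nextRight S n a

/-- The angle at `n` that a message from `a` passes. -/
def passedAngle (S : Finset ℂ) (n a : ℂ) : Direction → ℂ × ℂ
  | .left => (a, nextLeft S n a)
  | .right => (nextRight S n a, a)

/-- The pairs of mates that `n` injects when a message passes its angle `p`: none if `p` does not
intersect the tree, and otherwise one pair for each other angle that does. -/
def split {k : ℕ} (S : Finset ℂ) (n : ℂ) (h : Header k) (p : ℂ × ℂ) : Multiset (Message k) :=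
  if AngleIntersects h.tree n p then
    ∑ q ∈ (angles S n).filter (fun q => q ≠ p ∧ AngleIntersects h.tree n q), inject h n q
  else 0

/-- The new send queue of a node with coordinates `n`, neighbours `S` and send queue `SQ` when it
receives the message `m`. If the mate of `m` is in the queue, then both are destroyed. Otherwise
`m` is forwarded by its traversal rule, and is split if `n` has to. -/
def receive {k : ℕ} (S : Finset ℂ) (n : ℂ) (SQ : Multiset (Message k)) (m : Message k) :
    Multiset (Message k) :=
  if m.mate ∈ SQ then SQ.erase m.mate
  else
    SQ + {⟨m.dir, m.header, n, nextHop S n m.sender m.dir⟩}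
      + split S n m.header (passedAngle S n m.sender m.dir)

/-- Whether the node `n` with send queue `SQ` delivers the message `m` that it receives. -/
def Delivers {k : ℕ} (n : ℂ) (SQ : Multiset (Message k)) (m : Message k) : Prop :=
  m.mate ∉ SQ ∧ n ∈ m.header.targets

/-! ### Computations -/

/-- A global state: the send queue of every node, and the nodes to which the message has been
delivered so far. The latter is only a record of the delivery events, and no node can read it. -/
structure State (k : ℕ) where
  queue : ℂ → Multiset (Message k)
  delivered : Set ℂ

/-- The initial state: only the queue of the source is filled. -/
def initial {k : ℕ} (G : Network) (h : Header k) : State k where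
  queue := fun u => if u = h.source then start (G.neighbors h.source) h else 0
  delivered := ∅

/-- The state after node `u` has transmitted `m`: the message is taken from the queue of `u` and
processed by its receiver. -/
def transmit {k : ℕ} (G : Network) (σ : State k) (u : ℂ) (m : Message k) : State k :=
  let q := Function.update σ.queue u ((σ.queue u).erase m)
  let n := m.receiver
  { queue := Function.update q n (receive (G.neighbors n) n (q n) m)
    delivered := {v | v ∈ σ.delivered ∨ (v = n ∧ Delivers n (q n) m)} }

/-- One atomic step: node `u` transmits to a neighbour any one message of its send queue. -/
def Step {k : ℕ} (G : Network) (σ : State k) (u : ℂ) (m : Message k) (σ' : State k) : Prop :=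
  m ∈ σ.queue u ∧ G.graph.Adj u m.receiver ∧ σ' = transmit G σ u m

/-- A computation: a finite or infinite sequence of steps that starts in the initial state. Its
states are `state i` for `i ≤ length`. -/
structure Computation {k : ℕ} (G : Network) (h : Header k) where
  /-- the number of steps -/
  length : ℕ∞
  state : ℕ → State k
  state_zero : state 0 = initial G h
  step : ∀ i : ℕ, (i : ℕ∞) < length → ∃ u m, Step G (state i) u m (state (i + 1))

/-- A computation is fair if every message in a send queue leaves this queue later on, because it
is transmitted or because it is removed. -/
def Computation.IsFair {k : ℕ} {G : Network} {h : Header k} (C : Computation G h) : Prop :=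
  ∀ (i : ℕ) (u : ℂ) (m : Message k), (i : ℕ∞) ≤ C.length → m ∈ (C.state i).queue u →
    ∃ j : ℕ, i ≤ j ∧ (j : ℕ∞) < C.length ∧
      ((C.state (j + 1)).queue u).count m < ((C.state j).queue u).count m

/-- A computation is finite if it has finitely many steps. -/
def Computation.IsFinite {k : ℕ} {G : Network} {h : Header k} (C : Computation G h) : Prop :=
  C.length ≠ ⊤

/-- The message is delivered to `t` in the course of the computation. -/
def Computation.DeliversTo {k : ℕ} {G : Network} {h : Header k} (C : Computation G h)
    (t : ℂ) : Prop :=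
  ∃ i : ℕ, (i : ℕ∞) ≤ C.length ∧ t ∈ (C.state i).delivered

end

end MCFR

/-! Termination is a counting argument. Let `V` be the set of visited angles and `Z` the set of
sides of edges already traversed. The queues hold exactly the messages that leave a visited angle
along a side outside `Z`, each once (`Invariant`). Every transmission puts one new side into `Z`:
either the two mates on that side annihilate, or the angle ahead becomes visited. So the number of
steps is at most the number of oriented edges (`Computation.isFinite`).

By fairness the queues are empty at the end. Then `V` is a union of full face traversals
(`Invariant.isFaceClosed`). Splitting makes a node visit all its angles that intersect the tree or
none of them, so an edge that meets the tree has both sides visited or neither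
(`Invariant.boundary_disjoint`).

Delivery now follows from winding numbers, without treating faces as regions. Let `turning` be the
total angle that the visited darts sweep around a point. It takes values in the multiples of π off
the nodes, and it is continuous away from edges with exactly one visited side; hence it is constant
on the tree (`turning_eq_of_segment`). On the other hand, `turning` plus the total visited angle at
a node is constant along the edges of the network (`nodeLevel_eq_of_adj`). The source lies on the
tree, so all its angles are visited and their sum is 2π. A reachable target without visited angles
would have sum 0, although both `turning` and the corrected quantity agree at the two nodes. So some
angle of the target is visited, and the visit delivers the message. -/

namespace MCFR

/-! ### Cyclic order of the neighbours of a node, and a symmetric argument function -/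

section

open scoped Classical

/-! ### Counter-clockwise angles -/

theorem ccwAngle_pos (u v w : ℂ) : 0 < ccwAngle u v w :=
  (toIocMod_mem_Ioc Real.two_pi_pos 0 _).1

theorem ccwAngle_le (u v w : ℂ) : ccwAngle u v w ≤ 2 * Real.pi :=
  (toIocMod_mem_Ioc Real.two_pi_pos 0 _).2.trans_eq (zero_add _)

theorem coe_ccwAngle (u v w : ℂ) :
    (ccwAngle u v w : Real.Angle) = (Complex.arg ((w - u) / (v - u)) : Real.Angle) := by
  rw [Real.Angle.angle_eq_iff_two_pi_dvd_sub]
  refine ⟨-toIocDiv Real.two_pi_pos 0 (Complex.arg ((w - u) / (v - u))), ?_⟩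
  simp only [ccwAngle, toIocMod, zsmul_eq_mul]
  push_cast
  ring

/-- The two sides agree modulo 2π, and the range `(0, 2π]` of all three angles leaves only the
differences 0 and 2π. -/
theorem ccwAngle_add {u a b x : ℂ} (ha : a ≠ u) (hb : b ≠ u) (hx : x ≠ u) :
    ccwAngle u a x + ccwAngle u x b = ccwAngle u a b ∨
      ccwAngle u a x + ccwAngle u x b = ccwAngle u a b + 2 * Real.pi := by
  have h : ((ccwAngle u a x + ccwAngle u x b : ℝ) : Real.Angle) = (ccwAngle u a b : ℝ) := by
    rw [Real.Angle.coe_add, coe_ccwAngle, coe_ccwAngle, coe_ccwAngle,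
      ← Complex.arg_mul_coe_angle (div_ne_zero (sub_ne_zero.2 hx) (sub_ne_zero.2 ha))
        (div_ne_zero (sub_ne_zero.2 hb) (sub_ne_zero.2 hx))]
    congr 2
    have := sub_ne_zero.2 hx
    field_simp
  obtain ⟨k, hk⟩ := Real.Angle.angle_eq_iff_two_pi_dvd_sub.1 h
  have h1 := ccwAngle_pos u a x
  have h2 := ccwAngle_pos u x b
  have h3 := ccwAngle_pos u a b
  have h4 := ccwAngle_le u a x
  have h5 := ccwAngle_le u x b
  have h6 := ccwAngle_le u a b
  have hpi := Real.pi_pos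
  have k1 : (-1 : ℝ) < k := by
    by_contra! hc
    nlinarith
  have k2 : (k : ℝ) < 2 := by
    by_contra! hc
    nlinarith
  have k1' : -1 < k := by exact_mod_cast k1
  have k2' : k < 2 := by exact_mod_cast k2
  obtain rfl | rfl : k = 0 ∨ k = 1 := by omega
  · left
    push_cast at hk
    linarith
  · right
    push_cast at hk
    linarith

theorem ccwAngle_eq_two_pi {u a b : ℂ} (h : ccwAngle u a b = 2 * Real.pi) :
    SameRay ℝ (a - u) (b - u) := by
  refine SameRay.symm ?_
  rw [Complex.sameRay_iff_arg_div_eq_zero]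
  have h1 := coe_ccwAngle u a b
  rw [h, Real.Angle.coe_two_pi, ← Real.Angle.coe_zero] at h1
  have h2 := congrArg Real.Angle.toReal h1
  rw [Complex.arg_coe_angle_toReal_eq_arg] at h2
  simpa using h2.symm

theorem ccwAngle_self (u a : ℂ) : ccwAngle u a a = 2 * Real.pi := by
  have h : Complex.arg ((a - u) / (a - u)) = 0 := by
    by_cases ha : a - u = 0
    · simp [ha]
    · simp [div_self ha]
  rw [ccwAngle, h]
  simp

/-- No two points of `S` lie in the same direction from `u`. -/
def DistinctRays (S : Finset ℂ) (u : ℂ) : Prop :=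
  (∀ a ∈ S, a ≠ u) ∧ ∀ a ∈ S, ∀ b ∈ S, SameRay ℝ (a - u) (b - u) → a = b

variable {S : Finset ℂ} {u : ℂ}

theorem DistinctRays.eq_of_ccwAngle_left (hS : DistinctRays S u) {a b c : ℂ} (ha : a ∈ S)
    (hb : b ∈ S) (hc : c ∈ S) (h : ccwAngle u a b = ccwAngle u a c) : b = c := by
  refine hS.2 b hb c hc (ccwAngle_eq_two_pi ?_)
  have h1 := ccwAngle_pos u b c
  rcases ccwAngle_add (hS.1 a ha) (hS.1 c hc) (hS.1 b hb) with h2 | h2 <;> linarith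

theorem DistinctRays.eq_of_ccwAngle_right (hS : DistinctRays S u) {a b c : ℂ} (ha : a ∈ S)
    (hb : b ∈ S) (hc : c ∈ S) (h : ccwAngle u b a = ccwAngle u c a) : b = c := by
  refine hS.2 b hb c hc (ccwAngle_eq_two_pi ?_)
  have h1 := ccwAngle_pos u b c
  rcases ccwAngle_add (hS.1 b hb) (hS.1 a ha) (hS.1 c hc) with h2 | h2 <;> linarith

/-- If no `x` lies strictly inside the sector from `a` to `b`, the detour from `a` over `x` to `b`
is longer by a full turn. Neither part exceeds a full turn, so each part is at least the angle from
`a` to `b`. -/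
theorem DistinctRays.isNextLeft_iff_isNextRight (hS : DistinctRays S u) {a b : ℂ} :
    IsNextLeft S u a b ↔ IsNextRight S u b a := by
  constructor
  · rintro ⟨ha, hb, h⟩
    refine ⟨hb, ha, fun x hx => ?_⟩
    have h1 := h x hx
    have h2 := ccwAngle_pos u x b
    have h3 := ccwAngle_le u a x
    rcases ccwAngle_add (hS.1 a ha) (hS.1 b hb) (hS.1 x hx) with h4 | h4 <;> linarith
  · rintro ⟨hb, ha, h⟩
    refine ⟨ha, hb, fun x hx => ?_⟩
    have h1 := h x hx
    have h2 := ccwAngle_pos u a x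
    have h3 := ccwAngle_le u x b
    rcases ccwAngle_add (hS.1 a ha) (hS.1 b hb) (hS.1 x hx) with h4 | h4 <;> linarith

theorem isNextLeft_nextLeft {a : ℂ} (ha : a ∈ S) : IsNextLeft S u a (nextLeft S u a) :=
  Classical.epsilon_spec (exists_isNextLeft u ha)

theorem isNextRight_nextRight {a : ℂ} (ha : a ∈ S) : IsNextRight S u a (nextRight S u a) :=
  Classical.epsilon_spec (exists_isNextRight u ha)

theorem nextLeft_mem {a : ℂ} (ha : a ∈ S) : nextLeft S u a ∈ S := (isNextLeft_nextLeft ha).2.1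

theorem nextRight_mem {a : ℂ} (ha : a ∈ S) : nextRight S u a ∈ S := (isNextRight_nextRight ha).2.1

theorem DistinctRays.nextLeft_eq (hS : DistinctRays S u) {a b : ℂ} (h : IsNextLeft S u a b) :
    nextLeft S u a = b := by
  have h' := isNextLeft_nextLeft (u := u) h.1
  exact hS.eq_of_ccwAngle_left h.1 h'.2.1 h.2.1
    (le_antisymm (h'.2.2 _ h.2.1) (h.2.2 _ h'.2.1))

theorem DistinctRays.nextRight_eq (hS : DistinctRays S u) {a b : ℂ} (h : IsNextRight S u a b) :
    nextRight S u a = b := by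
  have h' := isNextRight_nextRight (u := u) h.1
  exact hS.eq_of_ccwAngle_right h.1 h'.2.1 h.2.1
    (le_antisymm (h'.2.2 _ h.2.1) (h.2.2 _ h'.2.1))

theorem DistinctRays.nextRight_nextLeft (hS : DistinctRays S u) {a : ℂ} (ha : a ∈ S) :
    nextRight S u (nextLeft S u a) = a :=
  hS.nextRight_eq (hS.isNextLeft_iff_isNextRight.1 (isNextLeft_nextLeft ha))

theorem DistinctRays.nextLeft_nextRight (hS : DistinctRays S u) {a : ℂ} (ha : a ∈ S) :
    nextLeft S u (nextRight S u a) = a :=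
  hS.nextLeft_eq (hS.isNextLeft_iff_isNextRight.2 (isNextRight_nextRight ha))

theorem DistinctRays.mem_angles_iff (hS : DistinctRays S u) {p : ℂ × ℂ} :
    p ∈ angles S u ↔ p.1 ∈ S ∧ p.2 = nextLeft S u p.1 := by
  constructor
  · intro h
    have h' := (Finset.mem_filter.1 h).2
    exact ⟨h'.1, (hS.nextLeft_eq h').symm⟩
  · rintro ⟨h1, h2⟩
    simp only [angles, Finset.mem_filter, Finset.mem_product, h2]
    exact ⟨⟨h1, nextLeft_mem h1⟩, isNextLeft_nextLeft h1⟩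

/-! ### The argument with the value zero on the branch cut -/

/-- The argument of a complex number, set to zero on the negative real axis. This makes it odd
under inversion everywhere. -/
noncomputable def symArg (z : ℂ) : ℝ := if z ∈ Complex.slitPlane then Complex.arg z else 0

theorem symArg_of_mem {z : ℂ} (hz : z ∈ Complex.slitPlane) : symArg z = Complex.arg z := if_pos hz

theorem symArg_of_notMem {z : ℂ} (hz : z ∉ Complex.slitPlane) : symArg z = 0 := if_neg hz

theorem inv_mem_slitPlane_iff {z : ℂ} : z⁻¹ ∈ Complex.slitPlane ↔ z ∈ Complex.slitPlane := by
  simp only [Complex.mem_slitPlane_iff_arg, Complex.arg_inv, ne_eq,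
    inv_eq_zero]
  refine and_congr_left fun _ => ?_
  split_ifs with h
  · simp [h]
  · simp only [h, not_false_iff, iff_true]
    have := Complex.neg_pi_lt_arg z
    intro h'
    linarith

theorem symArg_inv (z : ℂ) : symArg z⁻¹ = -symArg z := by
  by_cases hz : z ∈ Complex.slitPlane
  · rw [symArg_of_mem hz, symArg_of_mem (inv_mem_slitPlane_iff.2 hz), Complex.arg_inv,
      if_neg (Complex.mem_slitPlane_iff_arg.1 hz).1]
  · rw [symArg_of_notMem hz, symArg_of_notMem (inv_mem_slitPlane_iff.not.2 hz), neg_zero]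

theorem continuousAt_symArg {z : ℂ} (hz : z ∈ Complex.slitPlane) : ContinuousAt symArg z := by
  refine (Complex.continuousAt_arg hz).congr ?_
  filter_upwards [Complex.isOpen_slitPlane.mem_nhds hz] with w hw
  exact (symArg_of_mem hw).symm

theorem symArg_real_mul {r : ℝ} (hr : 0 < r) (z : ℂ) : symArg (r * z) = symArg z := by
  have h : (r * z : ℂ) ∈ Complex.slitPlane ↔ z ∈ Complex.slitPlane := by
    simp [Complex.mem_slitPlane_iff_arg, Complex.arg_real_mul z hr, hr.ne']
  by_cases hz : z ∈ Complex.slitPlane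
  · rw [symArg_of_mem hz, symArg_of_mem (h.2 hz), Complex.arg_real_mul z hr]
  · rw [symArg_of_notMem hz, symArg_of_notMem (h.not.2 hz)]

/-- On the branch cut `symArg` is 0 where the argument is π; doubling makes the two
indistinguishable. -/
theorem exp_two_mul_symArg {z : ℂ} (hz : z ≠ 0) :
    Complex.exp (2 * symArg z * Complex.I) = (z / ‖z‖) ^ 2 := by
  have hn : (‖z‖ : ℂ) ≠ 0 := by simpa using hz
  have key : Complex.exp (Complex.arg z * Complex.I) = z / ‖z‖ := by
    rw [eq_div_iff hn, mul_comm]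
    exact Complex.norm_mul_exp_arg_mul_I z
  by_cases h : z ∈ Complex.slitPlane
  · rw [symArg_of_mem h, ← key, ← Complex.exp_nat_mul]
    congr 1
    push_cast
    ring
  · rw [symArg_of_notMem h, ← key]
    have : Complex.arg z = Real.pi := by
      by_contra hc
      exact h (Complex.mem_slitPlane_iff_arg.2 ⟨hc, hz⟩)
    simp [this]

theorem symArg_neg_of_not_sameRay {u a b : ℂ} (ha : a ≠ u) (hb : b ≠ u)
    (h : ¬ SameRay ℝ (a - u) (b - u)) :
    symArg (-((b - u) / (a - u))) = ccwAngle u a b - Real.pi := by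
  have hz : (b - u) / (a - u) ≠ 0 := div_ne_zero (sub_ne_zero.2 hb) (sub_ne_zero.2 ha)
  have h1 : ccwAngle u a b < 2 * Real.pi :=
    lt_of_le_of_ne (ccwAngle_le u a b) fun hc => h (ccwAngle_eq_two_pi hc)
  have h2 := ccwAngle_pos u a b
  have h3 : ((Complex.arg (-((b - u) / (a - u))) : ℝ) : Real.Angle)
      = ((ccwAngle u a b - Real.pi : ℝ) : Real.Angle) := by
    rw [Complex.arg_neg_coe_angle hz, Real.Angle.coe_sub, coe_ccwAngle,
      Real.Angle.sub_coe_pi_eq_add_coe_pi]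
  have h4 := congrArg Real.Angle.toReal h3
  rw [Complex.arg_coe_angle_toReal_eq_arg,
    Real.Angle.toReal_coe_eq_self_iff.2 ⟨by linarith, by linarith⟩] at h4
  rw [symArg_of_mem, h4]
  rw [Complex.mem_slitPlane_iff_arg]
  exact ⟨by rw [h4]; linarith, neg_ne_zero.2 hz⟩

/-- This is the angle swept by the dart from `u` to `b`, seen from a point of the edge `ua` in the
limit towards `u`. For `b = a` the viewpoint is on the dart itself, and the branch-cut value 0 costs
an extra π. -/
theorem DistinctRays.symArg_neg (hS : DistinctRays S u) {a b : ℂ} (ha : a ∈ S) (hb : b ∈ S) :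
    symArg (-((b - u) / (a - u))) =
      ccwAngle u a b - Real.pi - if b = a then Real.pi else 0 := by
  split_ifs with h
  · subst h
    rw [div_self (sub_ne_zero.2 (hS.1 _ ha)), ccwAngle_self, symArg_of_notMem]
    · ring
    · simp [Complex.mem_slitPlane_iff]
  · rw [symArg_neg_of_not_sameRay (hS.1 a ha) (hS.1 b hb) fun hc => h (hS.2 a ha b hb hc).symm,
      sub_zero]

/-- How the angle to a fixed ray changes from a neighbour to the next one. -/
theorem DistinctRays.symArg_nextLeft_sub (hS : DistinctRays S u) {a b : ℂ} (ha : a ∈ S)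
    (hb : b ∈ S) :
    symArg (-((nextLeft S u b - u) / (a - u))) - symArg (-((b - u) / (a - u))) =
      ccwAngle u b (nextLeft S u b) - (if b = a then Real.pi else 0)
        - if nextLeft S u b = a then Real.pi else 0 := by
  have hn := isNextLeft_nextLeft (u := u) hb
  rw [hS.symArg_neg ha hb, hS.symArg_neg ha hn.2.1]
  -- Measured from `a`, the angle drops by a full turn when the ray to `a` is passed. The convention
  -- for `symArg` shares this drop equally between arriving at `a` and leaving it.
  suffices h : ccwAngle u a (nextLeft S u b) - ccwAngle u a b =
      ccwAngle u b (nextLeft S u b) - if b = a then 2 * Real.pi else 0 by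
    split_ifs at h ⊢ <;> linarith
  split_ifs with h
  · subst h
    rw [ccwAngle_self]
  · have h1 := hn.2.2 a ha
    have h2 : ccwAngle u a b + ccwAngle u b a = 2 * Real.pi := by
      have h3 := ccwAngle_add (hS.1 a ha) (hS.1 a ha) (hS.1 b hb)
      rw [ccwAngle_self] at h3
      have h4 : ccwAngle u a b ≠ 2 * Real.pi := fun hc =>
        h (hS.2 a ha b hb (ccwAngle_eq_two_pi hc)).symm
      have h5 := lt_of_le_of_ne (ccwAngle_le u a b) h4
      have h6 := ccwAngle_le u b a
      rcases h3 with h3 | h3 <;> linarith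
    have h7 := ccwAngle_pos u a (nextLeft S u b)
    rcases ccwAngle_add (hS.1 a ha) (hS.1 _ hn.2.1) (hS.1 b hb) with h3 | h3 <;> linarith

/-- Summation by parts around a node: `f` marks the angles, by their first neighbours. -/
theorem DistinctRays.sum_symArg (hS : DistinctRays S u) (f : ℂ → ℝ) {a : ℂ} (ha : a ∈ S) :
    ∑ b ∈ S, (f (nextRight S u b) - f b) * symArg (-((b - u) / (a - u))) =
      ∑ b ∈ S, f b * ccwAngle u b (nextLeft S u b)
        - Real.pi * (f a + f (nextRight S u a)) := by
  have h1 : ∑ b ∈ S, f (nextRight S u b) * symArg (-((b - u) / (a - u))) =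
      ∑ b ∈ S, f b * symArg (-((nextLeft S u b - u) / (a - u))) :=
    Finset.sum_nbij' (nextRight S u) (nextLeft S u) (fun b hb => nextRight_mem hb)
      (fun b hb => nextLeft_mem hb) (fun b hb => hS.nextLeft_nextRight hb)
      (fun b hb => hS.nextRight_nextLeft hb) (fun b hb => by rw [hS.nextLeft_nextRight hb])
  have h2 : ∀ b ∈ S, f b * (if nextLeft S u b = a then Real.pi else 0) =
      if b = nextRight S u a then f b * Real.pi else 0 := by
    intro b hb
    have : nextLeft S u b = a ↔ b = nextRight S u a :=
      ⟨fun h => by rw [← h, hS.nextRight_nextLeft hb], fun h => by rw [h, hS.nextLeft_nextRight ha]⟩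
    simp only [this, mul_ite, mul_zero]
  have h3 : ∀ b ∈ S, f b * symArg (-((nextLeft S u b - u) / (a - u)))
      - f b * symArg (-((b - u) / (a - u))) =
      f b * ccwAngle u b (nextLeft S u b) - (if b = a then f b * Real.pi else 0)
        - if b = nextRight S u a then f b * Real.pi else 0 := by
    intro b hb
    rw [← h2 b hb, ← mul_sub, hS.symArg_nextLeft_sub ha hb]
    split_ifs <;> ring
  simp only [sub_mul, Finset.sum_sub_distrib]
  rw [h1, ← Finset.sum_sub_distrib, Finset.sum_congr rfl h3, Finset.sum_sub_distrib,
    Finset.sum_sub_distrib, Finset.sum_ite_eq' S a, Finset.sum_ite_eq' S (nextRight S u a),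
    if_pos ha, if_pos (nextRight_mem ha)]
  ring

end

/-! ### Plane topology: turning numbers of face-closed sets of darts -/

section

open scoped Classical
open Filter Topology

/-! ### Planar networks -/

variable {G : Network}

theorem Network.mem_neighbors {u v : ℂ} : v ∈ G.neighbors u ↔ G.graph.Adj u v := by
  simp only [Network.neighbors, Finset.mem_filter, and_iff_right_iff_imp]
  exact fun h => G.mem_nodes h.symm

theorem segment_inter_of_sameRay {n a b : ℂ} (h : SameRay ℝ (a - n) (b - n)) :
    b ∈ segment ℝ n a ∨ a ∈ segment ℝ n b := by
  by_cases ha : a - n = 0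
  · right
    rw [sub_eq_zero.1 ha]
    exact left_mem_segment ℝ n b
  by_cases hb : b - n = 0
  · left
    rw [sub_eq_zero.1 hb]
    exact left_mem_segment ℝ n a
  obtain ⟨r, t, hr, ht, h⟩ := h.exists_pos ha hb
  simp only [segment_eq_image', Complex.real_smul] at h ⊢
  rcases le_total r t with hrt | hrt
  · left
    refine ⟨r / t, ⟨by positivity, (div_le_one ht).2 hrt⟩, ?_⟩
    have : (t : ℂ) ≠ 0 := by exact_mod_cast ht.ne'
    simp only [Complex.ofReal_div]
    field_simp
    linear_combination h
  · right
    refine ⟨t / r, ⟨by positivity, (div_le_one hr).2 hrt⟩, ?_⟩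
    have : (r : ℂ) ≠ 0 := by exact_mod_cast hr.ne'
    simp only [Complex.ofReal_div]
    field_simp
    linear_combination -h

/-- Of two neighbours in the same direction, the nearer one would lie on the edge to the other. -/
theorem Network.IsPlanar.distinctRays (hG : G.IsPlanar) (n : ℂ) :
    DistinctRays (G.neighbors n) n := by
  refine ⟨fun a ha => (Network.mem_neighbors.1 ha).ne', fun a ha b hb h => ?_⟩
  rw [Network.mem_neighbors] at ha hb
  rcases segment_inter_of_sameRay h with h | h
  · rcases hG.1 n a b ha (G.mem_nodes hb.symm) h with h | h
    · exact absurd h hb.ne'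
    · exact h.symm
  · rcases hG.1 n b a hb (G.mem_nodes ha.symm) h with h | h
    · exact absurd h ha.ne'
    · exact h

/-- The edges of the network, with both orientations. -/
noncomputable def Network.darts (G : Network) : Finset (ℂ × ℂ) :=
  (G.nodes ×ˢ G.nodes).filter fun d => G.graph.Adj d.1 d.2

theorem Network.mem_darts {d : ℂ × ℂ} : d ∈ G.darts ↔ G.graph.Adj d.1 d.2 := by
  simp only [Network.darts, Finset.mem_filter, Finset.mem_product, and_iff_right_iff_imp]
  exact fun h => ⟨G.mem_nodes h, G.mem_nodes h.symm⟩

/-! ### The turning number of a set of darts -/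

variable {V : ℂ → ℂ → Prop}

/-- The darts that belong to `V`. -/
noncomputable def Network.dartsIn (G : Network) (V : ℂ → ℂ → Prop) : Finset (ℂ × ℂ) :=
  G.darts.filter fun d => V d.1 d.2

theorem Network.mem_dartsIn {d : ℂ × ℂ} :
    d ∈ G.dartsIn V ↔ G.graph.Adj d.1 d.2 ∧ V d.1 d.2 := by
  rw [Network.dartsIn, Finset.mem_filter, Network.mem_darts]

/-- `2π` times the winding number around `p` of the darts in `V`. -/
noncomputable def turning (G : Network) (V : ℂ → ℂ → Prop) (p : ℂ) : ℝ :=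
  ∑ d ∈ G.dartsIn V, symArg ((d.2 - p) / (d.1 - p))

/-- A set of darts is closed under face traversal if it contains with a dart its successor and its
predecessor on the same face. -/
def IsFaceClosed (G : Network) (V : ℂ → ℂ → Prop) : Prop :=
  ∀ a n, G.graph.Adj a n → (V a n ↔ V n (nextLeft (G.neighbors n) n a))

theorem IsFaceClosed.nextRight (hG : G.IsPlanar) (hV : IsFaceClosed G V) {n b : ℂ}
    (h : G.graph.Adj n b) : V (nextRight (G.neighbors n) n b) n ↔ V n b := by
  have hb := Network.mem_neighbors.2 h
  have h1 := Network.mem_neighbors.1 (nextRight_mem (u := n) hb)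
  rw [hV _ n h1.symm, (hG.distinctRays n).nextLeft_nextRight hb]

/-- Face traversal permutes the darts of `V` and turns the head of each dart into the tail of the
next. -/
theorem IsFaceClosed.prod_heads (hG : G.IsPlanar) (hV : IsFaceClosed G V) (f : ℂ → ℂ) :
    ∏ d ∈ G.dartsIn V, f d.2 = ∏ d ∈ G.dartsIn V, f d.1 := by
  refine Finset.prod_nbij' (fun d => (d.2, nextLeft (G.neighbors d.2) d.2 d.1))
    (fun d => (MCFR.nextRight (G.neighbors d.1) d.1 d.2, d.1)) ?_ ?_ ?_ ?_ ?_
  · rintro ⟨a, n⟩ h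
    rw [Network.mem_dartsIn] at h ⊢
    exact ⟨Network.mem_neighbors.1 (nextLeft_mem (Network.mem_neighbors.2 h.1.symm)),
      (hV a n h.1).1 h.2⟩
  · rintro ⟨n, b⟩ h
    rw [Network.mem_dartsIn] at h ⊢
    exact ⟨(Network.mem_neighbors.1 (nextRight_mem (Network.mem_neighbors.2 h.1))).symm,
      (hV.nextRight hG h.1).2 h.2⟩
  · rintro ⟨a, n⟩ h
    rw [Network.mem_dartsIn] at h
    simp only [(hG.distinctRays n).nextRight_nextLeft (Network.mem_neighbors.2 h.1.symm)]
  · rintro ⟨n, b⟩ h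
    rw [Network.mem_dartsIn] at h
    simp only [(hG.distinctRays n).nextLeft_nextRight (Network.mem_neighbors.2 h.1)]
  · rintro ⟨a, n⟩ _
    rfl

/-- The integer multiples of `π`. -/
def piMultiples : Set ℝ := Set.range fun k : ℤ => (k : ℝ) * Real.pi

theorem isClosedEmbedding_mul_pi : IsClosedEmbedding fun k : ℤ => (k : ℝ) * Real.pi :=
  (Homeomorph.mulRight₀ Real.pi Real.pi_ne_zero).isClosedEmbedding.comp
    Int.isClosedEmbedding_coe_real

theorem isClosed_piMultiples : IsClosed piMultiples := isClosedEmbedding_mul_pi.isClosed_range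

theorem isDiscrete_piMultiples : IsDiscrete piMultiples :=
  ⟨isClosedEmbedding_mul_pi.isEmbedding.toHomeomorph.symm.isEmbedding.discreteTopology⟩

/-- After exponentiation each dart contributes the squared unit direction to its head over that to
its tail, and these telescope around the faces. Squares are needed because `p` may lie on edges;
this gives multiples of π and not of 2π. -/
theorem turning_mem_piMultiples (hG : G.IsPlanar) (hV : IsFaceClosed G V) {p : ℂ}
    (hp : p ∉ G.nodes) : turning G V p ∈ piMultiples := by
  have h : Complex.exp (2 * turning G V p * Complex.I) = 1 := by
    rw [turning, Complex.ofReal_sum, Finset.mul_sum, Finset.sum_mul, Complex.exp_sum]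
    have hne : ∀ d ∈ G.dartsIn V, d.1 - p ≠ 0 ∧ d.2 - p ≠ 0 := by
      intro d hd
      have hd := (Network.mem_dartsIn.1 hd).1
      exact ⟨fun hc => hp (sub_eq_zero.1 hc ▸ G.mem_nodes hd),
        fun hc => hp (sub_eq_zero.1 hc ▸ G.mem_nodes hd.symm)⟩
    have h1 : ∀ d ∈ G.dartsIn V,
        Complex.exp (2 * symArg ((d.2 - p) / (d.1 - p)) * Complex.I) =
          ((d.2 - p) / ‖d.2 - p‖) ^ 2 / ((d.1 - p) / ‖d.1 - p‖) ^ 2 := by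
      intro d hd
      rw [exp_two_mul_symArg (div_ne_zero (hne d hd).2 (hne d hd).1), norm_div, ← div_pow,
        Complex.ofReal_div, div_div_div_comm]
    rw [Finset.prod_congr rfl h1, Finset.prod_div_distrib,
      hV.prod_heads hG fun z => ((z - p) / ‖z - p‖) ^ 2, div_self]
    refine Finset.prod_ne_zero_iff.2 fun d hd => pow_ne_zero _ (div_ne_zero (hne d hd).1 ?_)
    simpa using (hne d hd).1
  obtain ⟨k, hk⟩ := Complex.exp_eq_one_iff.1 h
  refine ⟨k, ?_⟩
  have h2 : (turning G V p : ℂ) = k * Real.pi := by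
    have h3 : (2 * Complex.I) * (turning G V p : ℂ) = (2 * Complex.I) * (k * Real.pi) := by
      linear_combination hk
    exact mul_left_cancel₀ (by simp) h3
  exact_mod_cast h2.symm

theorem div_mem_slitPlane {x y p : ℂ} (h : p ∉ segment ℝ x y) :
    (y - p) / (x - p) ∈ Complex.slitPlane := by
  by_contra hc
  rw [Complex.mem_slitPlane_iff_not_le_zero, not_not, Complex.le_def] at hc
  obtain ⟨hre, him⟩ := hc
  have hx : x - p ≠ 0 := fun hc => h (sub_eq_zero.1 hc ▸ left_mem_segment ℝ x y)
  set t : ℝ := -((y - p) / (x - p)).re with ht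
  have ht0 : 0 ≤ t := by simpa [ht] using hre
  have h1 : (y - p) / (x - p) = -(t : ℂ) := Complex.ext (by simp [ht]) (by simpa using him)
  rw [div_eq_iff hx] at h1
  have ht1 : (0 : ℝ) < 1 + t := by linarith
  refine h ⟨t / (1 + t), 1 / (1 + t), by positivity, by positivity, by field_simp; ring, ?_⟩
  have ht2 : (1 + t : ℂ) ≠ 0 := by exact_mod_cast ht1.ne'
  simp only [Complex.real_smul, Complex.ofReal_div, Complex.ofReal_add, Complex.ofReal_one]
  field_simp
  linear_combination h1

theorem continuousAt_symArg_div {x y p : ℂ} (h : p ∉ segment ℝ x y) :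
    ContinuousAt (fun q => symArg ((y - q) / (x - q))) p := by
  have hx : x - p ≠ 0 := fun hc => h (sub_eq_zero.1 hc ▸ left_mem_segment ℝ x y)
  exact ContinuousAt.comp (f := fun q => (y - q) / (x - q)) (g := symArg)
    (continuousAt_symArg (div_mem_slitPlane h)) (by fun_prop (disch := exact hx))

theorem symArg_div_eq_zero {x y p : ℂ} (h : p ∈ segment ℝ x y) :
    symArg ((y - p) / (x - p)) = 0 := by
  apply symArg_of_notMem
  rw [Complex.mem_slitPlane_iff_not_le_zero, not_not]
  rw [segment_eq_image'] at h
  obtain ⟨r, ⟨h0, h1⟩, rfl⟩ := h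
  have h2 : (y - (x + r • (y - x))) / (x - (x + r • (y - x))) =
      ((-((1 - r) / r) * ‖y - x‖ / ‖y - x‖ : ℝ) : ℂ) := by
    by_cases hxy : y - x = 0
    · simp [sub_eq_zero.1 hxy]
    have hn : (‖y - x‖ : ℂ) ≠ 0 := by simpa using hxy
    rcases h0.eq_or_lt with rfl | h0
    · simp
    have : (r : ℂ) ≠ 0 := by exact_mod_cast h0.ne'
    simp only [Complex.real_smul]
    push_cast
    rw [mul_div_cancel_right₀ _ hn, sub_add_cancel_left, div_eq_iff (by simp [this, hxy])]
    field_simp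
    ring
  rw [h2]
  have h3 : -((1 - r) / r) * ‖y - x‖ / ‖y - x‖ ≤ 0 := by
    rw [neg_mul, neg_div, neg_nonpos]
    have := sub_nonneg.2 h1
    positivity
  exact_mod_cast h3

/-- Opposite darts cancel. -/
theorem turning_eq_sum_unpaired (p : ℂ) : turning G V p =
    ∑ d ∈ (G.dartsIn V).filter (fun d => ¬ V d.2 d.1), symArg ((d.2 - p) / (d.1 - p)) := by
  rw [turning, ← Finset.sum_filter_add_sum_filter_not (G.dartsIn V) fun d => ¬ V d.2 d.1,
    add_eq_left]
  refine Finset.sum_involution (fun d _ => d.swap) ?_ ?_ ?_ ?_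
  · rintro ⟨x, y⟩ _
    rw [← inv_div, symArg_inv]
    simp
  · rintro ⟨x, y⟩ h _ hc
    have h1 := (Network.mem_dartsIn.1 (Finset.mem_filter.1 h).1).1
    exact h1.ne (Prod.ext_iff.1 hc).2
  · rintro ⟨x, y⟩ h
    simp only [Finset.mem_filter, Network.mem_dartsIn, not_not, Prod.swap] at h ⊢
    exact ⟨⟨h.1.1.symm, h.2⟩, h.1.2⟩
  · simp

/-- Only unpaired darts survive cancellation, and by hypothesis `p` lies on none of them. -/
theorem continuousAt_turning {p : ℂ}
    (h : ∀ x y, G.graph.Adj x y → p ∈ segment ℝ x y → (V x y ↔ V y x)) :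
    ContinuousAt (turning G V) p := by
  have h1 : turning G V = fun p =>
      ∑ d ∈ (G.dartsIn V).filter (fun d => ¬ V d.2 d.1), symArg ((d.2 - p) / (d.1 - p)) :=
    funext turning_eq_sum_unpaired
  rw [h1]
  refine tendsto_finsetSum _ fun d hd => continuousAt_symArg_div fun hp => ?_
  rw [Finset.mem_filter, Network.mem_dartsIn] at hd
  exact hd.2 ((h _ _ hd.1.1 hp).1 hd.1.2)

theorem turning_eq_of_segment (hG : G.IsPlanar) (hV : IsFaceClosed G V) {p q : ℂ}
    (h : ∀ x y, G.graph.Adj x y → (segment ℝ x y ∩ segment ℝ p q).Nonempty → (V x y ↔ V y x)) :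
    turning G V p = turning G V q := by
  have hc : ∀ z ∈ segment ℝ p q, ContinuousAt (turning G V) z := fun z hz =>
    continuousAt_turning fun x y hxy hz' => h x y hxy ⟨z, hz', hz⟩
  refine (convex_segment p q).isPreconnected.constant_of_mapsTo isDiscrete_piMultiples
    (f := turning G V) (fun z hz => (hc z hz).continuousWithinAt) (fun z hz => ?_)
    (left_mem_segment ℝ p q) (right_mem_segment ℝ p q)
  -- At a node integrality does not come from telescoping: the value there is a limit of values off
  -- the nodes, and the multiples of π form a closed set.
  have hd : Dense ((G.nodes : Set ℂ)ᶜ) := G.nodes.finite_toSet.countable.dense_compl ℝ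
  have h1 := (hc z hz).continuousWithinAt.mem_closure_image (hd z)
  refine isClosed_piMultiples.closure_subset_iff.2 ?_ h1
  rintro _ ⟨w, hw, rfl⟩
  exact turning_mem_piMultiples hG hV hw

/-! ### The turning number near a node -/

/-- The point of the segment from `n` to `a` at parameter `r`. -/
noncomputable def along (n a : ℂ) (r : ℝ) : ℂ := n + r * (a - n)

theorem along_mem_segment {n a : ℂ} {r : ℝ} (h0 : 0 ≤ r) (h1 : r ≤ 1) :
    along n a r ∈ segment ℝ n a := by
  rw [segment_eq_image']
  exact ⟨r, ⟨h0, h1⟩, by simp [along]⟩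

theorem along_ne {n a : ℂ} (h : a ≠ n) {r : ℝ} (h0 : 0 < r) (h1 : r < 1) :
    along n a r ≠ n ∧ along n a r ≠ a := by
  have ha := sub_ne_zero.2 h
  constructor
  · intro hc
    have : (r : ℂ) * (a - n) = 0 := by unfold along at hc; linear_combination hc
    rcases mul_eq_zero.1 this with h | h
    · exact h0.ne' (by exact_mod_cast h)
    · exact ha h
  · intro hc
    have : ((r - 1 : ℝ) : ℂ) * (a - n) = 0 := by
      unfold along at hc; push_cast; linear_combination hc
    rcases mul_eq_zero.1 this with h | h
    · exact (sub_neg.2 h1).ne (by exact_mod_cast h)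
    · exact ha h

theorem along_notMem_segment (hG : G.IsPlanar) {n a x y : ℂ} (ha : G.graph.Adj n a)
    (hxy : G.graph.Adj x y) (hne : s(n, a) ≠ s(x, y)) {r : ℝ} (h0 : 0 < r) (h1 : r < 1) :
    along n a r ∉ segment ℝ x y := by
  intro hc
  have h := (hG.2 n a x y ha hxy hne ⟨along_mem_segment h0.le h1.le, hc⟩).1
  have h' := along_ne ha.ne' h0 h1
  rcases h with h | h
  · exact h'.1 h
  · exact h'.2 h

theorem continuous_along (n a : ℂ) : Continuous (along n a) := by
  unfold along
  fun_prop

theorem along_notMem_nodes (hG : G.IsPlanar) {n a : ℂ} (ha : G.graph.Adj n a) {r : ℝ}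
    (h0 : 0 < r) (h1 : r < 1) : along n a r ∉ G.nodes := by
  intro hc
  have h' := along_ne ha.ne' h0 h1
  rcases hG.1 n a _ ha hc (along_mem_segment h0.le h1.le) with h | h
  · exact h'.1 h
  · exact h'.2 h

theorem symArg_div_along_self {n a x y : ℂ} (he : s(n, a) = s(x, y)) {r : ℝ} (h0 : 0 ≤ r)
    (h1 : r ≤ 1) : symArg ((y - along n a r) / (x - along n a r)) = 0 := by
  apply symArg_div_eq_zero
  rcases Sym2.eq_iff.1 he with ⟨rfl, rfl⟩ | ⟨rfl, rfl⟩
  · exact along_mem_segment h0 h1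
  · rw [segment_symm]
    exact along_mem_segment h0 h1

/-- The turning number is constant in the interior of an edge. -/
theorem turning_along (hG : G.IsPlanar) (hV : IsFaceClosed G V) {n a : ℂ} (ha : G.graph.Adj n a)
    {r r' : ℝ} (hr : r ∈ Set.Ioo (0 : ℝ) 1) (hr' : r' ∈ Set.Ioo (0 : ℝ) 1) :
    turning G V (along n a r) = turning G V (along n a r') := by
  refine isPreconnected_Ioo.constant_of_mapsTo isDiscrete_piMultiples
    (f := fun r => turning G V (along n a r)) ?_
    (fun r hr => turning_mem_piMultiples hG hV (along_notMem_nodes hG ha hr.1 hr.2)) hr hr'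
  unfold turning
  refine continuousOn_finsetSum _ fun d hd => ?_
  -- Darts on the edge itself contribute the constant 0, by the value of `symArg` on the branch cut;
  -- all others avoid the interior of the edge.
  by_cases he : s(n, a) = s(d.1, d.2)
  · refine continuousOn_const (c := (0 : ℝ)).congr fun r hr => ?_
    exact symArg_div_along_self he hr.1.le hr.2.le
  · intro r hr
    have h1 := continuousAt_symArg_div
      (along_notMem_segment hG ha (Network.mem_dartsIn.1 hd).1 he hr.1 hr.2)
    exact (ContinuousAt.comp (f := along n a) h1
      (continuous_along n a).continuousAt).continuousWithinAt

/-- Multiplied by `r > 0`, the ratio becomes `r - (b - n) / (a - n)`, which tends to a point off the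
branch cut. -/
theorem tendsto_symArg_near {n a b : ℂ} (ha : a ≠ n) (h : ¬ SameRay ℝ (a - n) (b - n)) :
    Tendsto (fun r : ℝ => symArg ((b - along n a r) / (n - along n a r))) (𝓝[>] 0)
      (𝓝 (symArg (-((b - n) / (a - n))))) := by
  have ha' := sub_ne_zero.2 ha
  have h1 : -((b - n) / (a - n)) ∈ Complex.slitPlane := by
    rw [Complex.mem_slitPlane_iff_not_le_zero, Complex.le_def]
    rintro ⟨hre, him⟩
    have h2 : (b - n) / (a - n) = ((((b - n) / (a - n)).re : ℝ) : ℂ) :=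
      Complex.ext (by simp) (by simpa using him)
    rw [div_eq_iff ha'] at h2
    rw [h2] at h
    exact h (SameRay.sameRay_nonneg_smul_right (a - n) (by simpa using hre))
  have h2 : Tendsto (fun r : ℝ => symArg (-((b - n) / (a - n)) + r)) (𝓝[>] 0)
      (𝓝 (symArg (-((b - n) / (a - n))))) := by
    have h3 : ContinuousAt (fun r : ℝ => -((b - n) / (a - n)) + (r : ℂ)) 0 := by fun_prop
    have h4 := ContinuousAt.comp (f := fun r : ℝ => -((b - n) / (a - n)) + (r : ℂ)) (g := symArg)
      (x := 0) (by simpa using continuousAt_symArg h1) h3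
    simpa [ContinuousAt, Function.comp_def] using h4.tendsto.mono_left nhdsWithin_le_nhds
  refine h2.congr' ?_
  filter_upwards [self_mem_nhdsWithin] with r hr
  have hr0 : (0 : ℝ) < r := hr
  rw [← symArg_real_mul (inv_pos.2 hr0)]
  congr 1
  have : (r : ℂ) ≠ 0 := by exact_mod_cast hr0.ne'
  have h5 : n - along n a r = -(r * (a - n)) := by
    unfold along; ring
  rw [h5]
  unfold along
  push_cast
  field_simp
  ring

theorem tendsto_symArg_dart (hG : G.IsPlanar) {n a x y : ℂ} (ha : G.graph.Adj n a)
    (hxy : G.graph.Adj x y) :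
    Tendsto (fun r : ℝ => symArg ((y - along n a r) / (x - along n a r))) (𝓝[>] 0)
      (𝓝 (symArg ((y - n) / (x - n)) + (if x = n then symArg (-((y - n) / (a - n))) else 0)
        - if y = n then symArg (-((x - n) / (a - n))) else 0)) := by
  have hS := hG.distinctRays n
  -- With division by zero equal to 0, a dart that starts or ends at `n` contributes 0 to the
  -- turning number at `n`; the two conditional terms are then its whole limit.
  have hzero : symArg 0 = 0 := symArg_of_notMem (by simp)
  have hone : symArg (-((a - n) / (a - n))) = 0 := by
    rw [div_self (sub_ne_zero.2 ha.ne'), symArg_of_notMem]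
    simp [Complex.mem_slitPlane_iff]
  have hincident : ∀ b, G.graph.Adj n b →
      Tendsto (fun r : ℝ => symArg ((b - along n a r) / (n - along n a r))) (𝓝[>] 0)
        (𝓝 (symArg (-((b - n) / (a - n))))) := by
    intro b hb
    by_cases hab : a = b
    · subst hab
      rw [hone]
      refine tendsto_const_nhds.congr' ?_
      filter_upwards [Ioo_mem_nhdsGT zero_lt_one] with r hr
      exact (symArg_div_along_self rfl hr.1.le hr.2.le).symm
    · exact tendsto_symArg_near ha.ne' fun hc =>
        hab (hS.2 a (Network.mem_neighbors.2 ha) b (Network.mem_neighbors.2 hb) hc)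
  by_cases hx : x = n
  · subst hx
    simpa [hxy.ne', hzero] using hincident y hxy
  by_cases hy : y = n
  · subst hy
    have h := (hincident x hxy.symm).neg
    simpa only [← symArg_inv, inv_div, sub_self, zero_div, hzero, if_neg hx, if_true, add_zero,
      zero_sub] using h
  · simp only [if_neg hx, if_neg hy, add_zero, sub_zero]
    have hn : n ∉ segment ℝ x y := fun hc => by
      rcases hG.1 x y n hxy (G.mem_nodes ha) hc with h | h
      · exact hx h.symm
      · exact hy h.symm
    have h1 : along n a 0 = n := by simp [along]
    have h2 : Tendsto (along n a) (𝓝[>] 0) (𝓝 n) := by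
      have := (continuous_along n a).continuousAt (x := 0)
      rw [ContinuousAt, h1] at this
      exact this.mono_left nhdsWithin_le_nhds
    exact (continuousAt_symArg_div hn).tendsto.comp h2

theorem sum_darts_from (n : ℂ) (f : ℂ → ℝ) :
    ∑ d ∈ G.dartsIn V, (if d.1 = n then f d.2 else 0) =
      ∑ b ∈ G.neighbors n, (if V n b then 1 else 0) * f b := by
  simp only [ite_mul, one_mul, zero_mul]
  rw [← Finset.sum_filter, ← Finset.sum_filter]
  refine Finset.sum_nbij' Prod.snd (fun b => (n, b)) ?_ ?_ ?_ ?_ ?_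
  · rintro ⟨x, y⟩ h
    simp only [Finset.mem_filter, Network.mem_dartsIn, Network.mem_neighbors] at h ⊢
    obtain ⟨h, rfl⟩ := h
    exact h
  · intro b h
    simpa only [Finset.mem_filter, Network.mem_dartsIn, Network.mem_neighbors, and_true] using h
  · rintro ⟨x, y⟩ h
    rw [← (Finset.mem_filter.1 h).2]
  · intros; rfl
  · intros; rfl

theorem sum_darts_to (n : ℂ) (f : ℂ → ℝ) :
    ∑ d ∈ G.dartsIn V, (if d.2 = n then f d.1 else 0) =
      ∑ b ∈ G.neighbors n, (if V b n then 1 else 0) * f b := by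
  simp only [ite_mul, one_mul, zero_mul]
  rw [← Finset.sum_filter, ← Finset.sum_filter]
  refine Finset.sum_nbij' Prod.fst (fun b => (b, n)) ?_ ?_ ?_ ?_ ?_
  · rintro ⟨x, y⟩ h
    simp only [Finset.mem_filter, Network.mem_dartsIn, Network.mem_neighbors] at h ⊢
    obtain ⟨h, rfl⟩ := h
    exact ⟨h.1.symm, h.2⟩
  · intro b h
    simp only [Finset.mem_filter, Network.mem_dartsIn, Network.mem_neighbors] at h ⊢
    exact ⟨⟨h.1.symm, h.2⟩, trivial⟩
  · rintro ⟨x, y⟩ h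
    rw [← (Finset.mem_filter.1 h).2]
  · intros; rfl
  · intros; rfl

/-- The turning number is constant inside the edge, so its midpoint value is the limit towards `n`.
This limit differs from the value at `n` only by the darts incident to `n`. -/
theorem turning_mid_eq (hG : G.IsPlanar) (hV : IsFaceClosed G V) {n a : ℂ}
    (ha : G.graph.Adj n a) : turning G V (along n a (1 / 2)) = turning G V n +
      ∑ b ∈ G.neighbors n, ((if V n b then 1 else 0) - (if V b n then 1 else 0)) *
        symArg (-((b - n) / (a - n))) := by
  have h1 : Tendsto (fun r => turning G V (along n a r)) (𝓝[>] 0)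
      (𝓝 (turning G V (along n a (1 / 2)))) := by
    refine tendsto_const_nhds.congr' ?_
    filter_upwards [Ioo_mem_nhdsGT zero_lt_one] with r hr
    exact turning_along hG hV ha (by norm_num) hr
  have h2 : Tendsto (fun r => turning G V (along n a r)) (𝓝[>] 0) (𝓝 _) :=
    tendsto_finsetSum _ fun d hd => tendsto_symArg_dart hG ha (Network.mem_dartsIn.1 hd).1
  rw [tendsto_nhds_unique h1 h2, Finset.sum_sub_distrib, Finset.sum_add_distrib,
    sum_darts_from n fun b => symArg (-((b - n) / (a - n))),
    sum_darts_to n fun b => symArg (-((b - n) / (a - n))), turning, add_sub_assoc,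
    ← Finset.sum_sub_distrib]
  simp only [sub_mul]

/-- The turning number at a node, corrected by the total size of the angles in `V`. -/
noncomputable def nodeLevel (G : Network) (V : ℂ → ℂ → Prop) (n : ℂ) : ℝ :=
  turning G V n + ∑ b ∈ G.neighbors n,
    (if V b n then 1 else 0) * ccwAngle n b (nextLeft (G.neighbors n) n b)

/-- Summation by parts (`DistinctRays.sum_symArg`) turns the jump at `n` into the visited angles at
`n` minus π for each visited side of the edge. What remains depends on the edge alone and is
symmetric in its ends. -/
theorem nodeLevel_eq (hG : G.IsPlanar) (hV : IsFaceClosed G V) {n a : ℂ}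
    (ha : G.graph.Adj n a) : nodeLevel G V n = turning G V (along n a (1 / 2)) +
      Real.pi * ((if V a n then 1 else 0) + if V n a then 1 else 0) := by
  have h := (hG.distinctRays n).sum_symArg (fun b => if V b n then 1 else 0)
    (Network.mem_neighbors.2 ha)
  have h1 : ∀ b ∈ G.neighbors n,
      ((if V (nextRight (G.neighbors n) n b) n then (1 : ℝ) else 0) = if V n b then 1 else 0) :=
    fun b hb => by simp only [hV.nextRight hG (Network.mem_neighbors.1 hb)]
  simp only [h1 a (Network.mem_neighbors.2 ha)] at h
  rw [turning_mid_eq hG hV ha, nodeLevel]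
  rw [Finset.sum_congr rfl fun b hb => by rw [h1 b hb]] at h
  rw [h]
  ring

theorem nodeLevel_eq_of_adj (hG : G.IsPlanar) (hV : IsFaceClosed G V) {n a : ℂ}
    (ha : G.graph.Adj n a) : nodeLevel G V n = nodeLevel G V a := by
  rw [nodeLevel_eq hG hV ha, nodeLevel_eq hG hV ha.symm]
  have : along a n (1 / 2) = along n a (1 / 2) := by
    unfold along
    push_cast
    ring
  rw [this, add_comm (if V a n then (1 : ℝ) else 0)]

theorem nodeLevel_eq_of_reachable (hG : G.IsPlanar) (hV : IsFaceClosed G V) {m n : ℂ}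
    (h : G.graph.Reachable m n) : nodeLevel G V m = nodeLevel G V n := by
  obtain ⟨w⟩ := h
  induction w with
  | nil => rfl
  | cons h _ ih => rw [nodeLevel_eq_of_adj hG hV h, ih]

theorem nodeLevel_of_forall_not {n : ℂ} (h : ∀ b, G.graph.Adj n b → ¬ V b n) :
    nodeLevel G V n = turning G V n := by
  rw [nodeLevel, Finset.sum_eq_zero, add_zero]
  intro b hb
  rw [if_neg (h b (Network.mem_neighbors.1 hb)), zero_mul]

theorem nodeLevel_of_forall (hG : G.IsPlanar) (hV : IsFaceClosed G V) {n a : ℂ}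
    (ha : G.graph.Adj n a) (h : ∀ b, G.graph.Adj n b → V b n) :
    nodeLevel G V n = turning G V n + 2 * Real.pi := by
  have h' : ∀ b, G.graph.Adj n b → V n b := fun b hb => (hV.nextRight hG hb).1
    (h _ (Network.mem_neighbors.1 (nextRight_mem (Network.mem_neighbors.2 hb))))
  rw [nodeLevel_eq hG hV ha, turning_mid_eq hG hV ha, if_pos (h a ha), if_pos (h' a ha),
    Finset.sum_eq_zero]
  · ring
  · intro b hb
    rw [Network.mem_neighbors] at hb
    rw [if_pos (h b hb), if_pos (h' b hb), sub_self, zero_mul]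

theorem exists_adj_of_reachable {m n : ℂ} (hne : m ≠ n) (h : G.graph.Reachable m n) :
    ∃ a, G.graph.Adj m a := by
  obtain ⟨w⟩ := h
  cases w with
  | nil => exact absurd rfl hne
  | cons h _ => exact ⟨_, h⟩

/-- A set of darts that is closed under face traversal and has no boundary on a connected
geometric graph `T` cannot contain all darts into one node on `T` and none of the darts into
another, if a path joins these nodes. -/
theorem exists_dart_of_reachable (hG : G.IsPlanar) (hV : IsFaceClosed G V) {k : ℕ}
    {T : PlaneGraph k} (hT : T.graph.Connected)
    (hTV : ∀ x y, G.graph.Adj x y → (segment ℝ x y ∩ T.carrier).Nonempty → (V x y ↔ V y x))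
    {i j : Fin k} (hne : T.point i ≠ T.point j)
    (hreach : G.graph.Reachable (T.point i) (T.point j))
    (hi : ∀ b, G.graph.Adj (T.point i) b → V b (T.point i)) :
    ∃ b, G.graph.Adj (T.point j) b ∧ V b (T.point j) := by
  by_contra! hj
  have h1 : ∀ i j, T.graph.Reachable i j →
      turning G V (T.point i) = turning G V (T.point j) := by
    rintro i j ⟨w⟩
    induction w with
    | nil => rfl
    | cons h _ ih =>
      refine (turning_eq_of_segment hG hV fun x y hxy ⟨z, hz, hz'⟩ => ?_).trans ih
      exact hTV x y hxy ⟨z, hz, Or.inr ⟨_, _, h, hz'⟩⟩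
  obtain ⟨a, ha⟩ := exists_adj_of_reachable hne hreach
  -- The path equates the levels and the tree equates the turning numbers, but their difference is
  -- 2π at one node and 0 at the other.
  have h3 := nodeLevel_eq_of_reachable hG hV hreach
  rw [nodeLevel_of_forall hG hV ha hi, nodeLevel_of_forall_not hj,
    h1 i j (hT.preconnected i j)] at h3
  have := Real.pi_pos
  linarith

end

/-! ### The algorithm: invariant, termination and delivery -/

section

open scoped Classical

variable {S : Finset ℂ} {n : ℂ} {G : Network} {k : ℕ} {h : Header k}

/-! ### Messages and the angles between which they travel -/

theorem Direction.opp_opp (d : Direction) : d.opp.opp = d := by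
  cases d <;> rfl

theorem Direction.opp_ne (d : Direction) : d.opp ≠ d := by
  cases d <;> simp [Direction.opp]

theorem DistinctRays.passedAngle_mem (hS : DistinctRays S n) {a : ℂ} (ha : a ∈ S)
    (d : Direction) : passedAngle S n a d ∈ angles S n := by
  rw [hS.mem_angles_iff]
  cases d
  · exact ⟨ha, rfl⟩
  · exact ⟨nextRight_mem ha, (hS.nextLeft_nextRight ha).symm⟩

theorem nextHop_mem {a : ℂ} (ha : a ∈ S) (d : Direction) : nextHop S n a d ∈ S := by
  cases d
  · exact nextLeft_mem ha
  · exact nextRight_mem ha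

theorem DistinctRays.passedAngle_nextHop (hS : DistinctRays S n) {a : ℂ} (ha : a ∈ S)
    (d : Direction) : passedAngle S n (nextHop S n a d) d.opp = passedAngle S n a d := by
  cases d
  · simp [passedAngle, nextHop, Direction.opp, hS.nextRight_nextLeft ha]
  · simp [passedAngle, nextHop, Direction.opp, hS.nextLeft_nextRight ha]

theorem passedAngle_injective {a b : ℂ} {d : Direction}
    (hab : passedAngle S n a d = passedAngle S n b d) : a = b := by
  cases d
  · exact congrArg Prod.fst hab
  · exact congrArg Prod.snd hab

/-- The angle at the sender that the message leaves behind. -/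
noncomputable def Message.fromAngle (G : Network) (m : Message k) : ℂ × ℂ :=
  passedAngle (G.neighbors m.sender) m.sender m.receiver m.dir.opp

/-- The angle at the receiver that the message is about to pass. -/
noncomputable def Message.toAngle (G : Network) (m : Message k) : ℂ × ℂ :=
  passedAngle (G.neighbors m.receiver) m.receiver m.sender m.dir

/-- The side of an edge along which the message travels: the edge, with the orientation of a
left-hand-rule message along this side. -/
def Message.dart (m : Message k) : ℂ × ℂ :=
  match m.dir with
  | .left => (m.sender, m.receiver)
  | .right => (m.receiver, m.sender)

theorem Message.fromAngle_mate (m : Message k) : m.mate.fromAngle G = m.toAngle G := by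
  simp only [Message.fromAngle, Message.toAngle, Message.mate, Direction.opp_opp]

theorem Message.dart_mate (m : Message k) : m.mate.dart = m.dart := by
  rcases m with ⟨_ | _, _, _, _⟩ <;> rfl

theorem Message.eq_or_eq_mate {m m' : Message k} (hh : m'.header = m.header)
    (hd : m'.dart = m.dart) : m' = m ∨ m' = m.mate := by
  rcases m with ⟨_ | _, _, _, _⟩ <;> rcases m' with ⟨_ | _, _, _, _⟩ <;>
    simp_all [Message.dart, Message.mate, Direction.opp]

theorem Message.eq_of_fromAngle {m m' : Message k} (hd : m'.dir = m.dir)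
    (hh : m'.header = m.header) (hs : m'.sender = m.sender)
    (hf : m'.fromAngle G = m.fromAngle G) : m' = m := by
  rcases m with ⟨d, h, a, b⟩
  rcases m' with ⟨d', h', a', b'⟩
  obtain rfl : d' = d := hd
  obtain rfl : h' = h := hh
  obtain rfl : a' = a := hs
  obtain rfl : b' = b := passedAngle_injective hf
  rfl

/-- The injected mates are exactly the two messages that leave `p`. In the angle `(c, c)` both go to
`c`, but their directions differ, so the multiplicity is still one. -/
theorem count_inject (hS : DistinctRays (G.neighbors n) n) {p : ℂ × ℂ}
    (hp : p ∈ angles (G.neighbors n) n) (m : Message k) :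
    (inject h n p).count m = if (m.header = h ∧ m.sender = n ∧ G.graph.Adj n m.receiver) ∧
      p = m.fromAngle G then 1 else 0 := by
  obtain ⟨c, d⟩ := p
  obtain ⟨hc, hd⟩ := hS.mem_angles_iff.1 hp
  simp only at hc hd
  have hc' := Network.mem_neighbors.1 hc
  have hd' := Network.mem_neighbors.1 (nextLeft_mem (u := n) hc)
  rcases m with ⟨_ | _, h', a, b⟩ <;>
  simp only [inject, Multiset.insert_eq_cons, Multiset.count_cons, Multiset.count_singleton,
    Message.mk.injEq, reduceCtorEq, false_and, true_and, if_false, add_zero, zero_add,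
    Message.fromAngle, Direction.opp, passedAngle, Prod.mk.injEq]
  · refine if_congr ⟨?_, ?_⟩ rfl rfl
    · rintro ⟨rfl, rfl, rfl⟩
      rw [hd, hS.nextRight_nextLeft hc]
      exact ⟨⟨rfl, rfl, hd'⟩, rfl, rfl⟩
    · rintro ⟨⟨rfl, rfl, -⟩, -, rfl⟩
      exact ⟨rfl, rfl, rfl⟩
  · refine if_congr ⟨?_, ?_⟩ rfl rfl
    · rintro ⟨rfl, rfl, rfl⟩
      exact ⟨⟨rfl, rfl, hc'⟩, rfl, hd⟩
    · rintro ⟨⟨rfl, rfl, -⟩, rfl, -⟩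
      exact ⟨rfl, rfl, rfl⟩

theorem count_sum_inject (hS : DistinctRays (G.neighbors n) n) {F : Finset (ℂ × ℂ)}
    (hF : F ⊆ angles (G.neighbors n) n) (m : Message k) :
    (∑ p ∈ F, inject h n p).count m =
      if (m.header = h ∧ m.sender = n ∧ G.graph.Adj n m.receiver) ∧ m.fromAngle G ∈ F
        then 1 else 0 := by
  rw [Multiset.count_sum', Finset.sum_congr rfl fun p hp => count_inject hS (hF hp) m]
  simp only [ite_and]
  split_ifs <;> simp_all

/-! ### The invariant -/

/-- The message `m` waits at `u`, if `V` are the angles visited so far (each with its node) and `Z`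
are the sides of edges that have been traversed completely. -/
def Pending (G : Network) (h : Header k) (V : Set (ℂ × ℂ × ℂ)) (Z : Finset (ℂ × ℂ)) (u : ℂ)
    (m : Message k) : Prop :=
  (m.header = h ∧ m.sender = u ∧ G.graph.Adj u m.receiver) ∧ (u, m.fromAngle G) ∈ V ∧ m.dart ∉ Z

/-- The state is determined by the visited angles `V` and the completely traversed sides of
edges `Z`, except for the deliveries. -/
structure Invariant (G : Network) (h : Header k) (σ : State k) (V : Set (ℂ × ℂ × ℂ))
    (Z : Finset (ℂ × ℂ)) : Prop where
  count_queue : ∀ u m, (σ.queue u).count m = if Pending G h V Z u m then 1 else 0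
  -- Applied to a message and to its mate, this says that the angles at both ends of a traversed
  -- side are visited.
  fromAngle_mem : ∀ m : Message k, m.header = h → G.graph.Adj m.sender m.receiver → m.dart ∈ Z →
    (m.sender, m.fromAngle G) ∈ V
  subset_darts : Z ⊆ G.darts
  -- This is the effect of splitting, and the only link between the visited angles and the tree away
  -- from the source.
  uniform : ∀ n, ∀ p ∈ angles (G.neighbors n) n, ∀ q ∈ angles (G.neighbors n) n,
    AngleIntersects h.tree n p → AngleIntersects h.tree n q → (n, p) ∈ V → (n, q) ∈ V
  delivered : ∀ n p, (n, p) ∈ V → n ∈ h.targets → n ∈ σ.delivered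
  source : ∀ p ∈ angles (G.neighbors h.source) h.source, AngleIntersects h.tree h.source p →
    (h.source, p) ∈ V

theorem invariant_initial (hG : G.IsPlanar) (hs : h.source ∉ h.targets) :
    Invariant G h (initial G h) {x | x.1 = h.source ∧ x.2 ∈ (angles (G.neighbors h.source)
      h.source).filter (AngleIntersects h.tree h.source)} ∅ where
  count_queue u m := by
    simp only [initial, start, Pending, Set.mem_ofPred_eq, Finset.notMem_empty, not_false_eq_true,
      and_true]
    by_cases hu : u = h.source
    · subst hu
      simp only [if_true, true_and]
      exact count_sum_inject (hG.distinctRays _) (Finset.filter_subset _ _) m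
    · simp [hu]
  fromAngle_mem := by simp
  subset_darts := by simp
  uniform n p _ q hq _ hq' := by
    rintro ⟨rfl, -⟩
    exact ⟨rfl, Finset.mem_filter.2 ⟨hq, hq'⟩⟩
  delivered n p := by
    rintro ⟨rfl, -⟩ hn
    exact absurd hn hs
  source p hp hp' := ⟨rfl, Finset.mem_filter.2 ⟨hp, hp'⟩⟩

theorem count_erase_ite {M : Type*} {s : Multiset M} {P : M → Prop}
    (hs : ∀ x, s.count x = if P x then 1 else 0) (a x : M) :
    (s.erase a).count x = if P x ∧ x ≠ a then 1 else 0 := by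
  by_cases hx : x = a
  · subst hx
    rw [Multiset.count_erase_self, hs]
    split_ifs <;> simp_all
  · rw [Multiset.count_erase_of_ne hx, hs]
    simp [hx]

variable {σ : State k} {V : Set (ℂ × ℂ × ℂ)} {Z : Finset (ℂ × ℂ)} {u : ℂ} {m : Message k}

theorem Invariant.mem_queue (hI : Invariant G h σ V Z) :
    m ∈ σ.queue u ↔ Pending G h V Z u m := by
  rw [← Multiset.count_pos, hI.count_queue]
  split_ifs <;> simp_all

theorem Message.dart_mem (hm : G.graph.Adj m.sender m.receiver) : m.dart ∈ G.darts := by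
  rcases m with ⟨_ | _, _, _, _⟩
  · exact Network.mem_darts.2 hm
  · exact Network.mem_darts.2 hm.symm

/-- A message meets its mate. -/
theorem Invariant.transmit_of_mem (hI : Invariant G h σ V Z)
    (hm : Pending G h V Z u m) (hmate : m.mate ∈ σ.queue m.receiver) :
    Invariant G h (transmit G σ u m) V (insert m.dart Z) := by
  obtain ⟨⟨hh, rfl, hadj⟩, hV, hZ⟩ := id hm
  have hmate' := hI.mem_queue.1 hmate
  -- No angle becomes visited, and only two messages travel along the newly traversed side: the two
  -- that are destroyed.
  have hiff : ∀ w m', Pending G h V (insert m.dart Z) w m' ↔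
      Pending G h V Z w m' ∧ m' ≠ m ∧ m' ≠ m.mate := by
    intro w m'
    simp only [Pending, Finset.mem_insert, not_or]
    constructor
    · rintro ⟨h1, h2, h3, h4⟩
      exact ⟨⟨h1, h2, h4⟩, fun hc => h3 (hc ▸ rfl), fun hc => h3 (hc ▸ m.dart_mate)⟩
    · rintro ⟨⟨h1, h2, h3⟩, h4, h5⟩
      refine ⟨h1, h2, fun hc => ?_, h3⟩
      rcases Message.eq_or_eq_mate (h1.1.trans hh.symm) hc with hc | hc
      · exact h4 hc
      · exact h5 hc
  refine ⟨fun w m' => ?_, fun m' h1 h2 h3 => ?_, ?_, hI.uniform, fun n p h1 h2 =>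
    Or.inl (hI.delivered n p h1 h2), hI.source⟩
  · rw [if_congr (hiff w m') rfl rfl]
    simp only [transmit, receive, Function.update_of_ne hadj.ne', if_pos hmate]
    by_cases hw : w = m.receiver
    · subst hw
      rw [Function.update_self, count_erase_ite (hI.count_queue _)]
      refine if_congr (and_congr_right fun h1 => ?_) rfl rfl
      exact (and_iff_right fun hc : m' = m => hadj.ne (hc ▸ h1.1.2.1)).symm
    rw [Function.update_of_ne hw]
    by_cases hw' : w = m.sender
    · subst hw'
      rw [Function.update_self, count_erase_ite (hI.count_queue _)]
      refine if_congr (and_congr_right fun h1 => ?_) rfl rfl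
      exact (and_iff_left fun hc : m' = m.mate => hw (by rw [← h1.1.2.1, hc]; rfl)).symm
    · rw [Function.update_of_ne hw', hI.count_queue]
      refine if_congr (iff_self_and.2 fun h1 => ⟨?_, ?_⟩) rfl rfl
      · exact fun hc => hw' (hc ▸ h1.1.2.1.symm)
      · exact fun hc => hw (by rw [← h1.1.2.1, hc]; rfl)
  · rcases Finset.mem_insert.1 h3 with h3 | h3
    · rcases Message.eq_or_eq_mate (h1.trans hh.symm) h3 with rfl | rfl
      · exact hV
      · exact hmate'.2.1
    · exact hI.fromAngle_mem m' h1 h2 h3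
  · exact Finset.insert_subset (Message.dart_mem hadj) hI.subset_darts

/-- The angles at the receiver into which it injects pairs when it receives the message. -/
noncomputable def Message.splitAngles (G : Network) (m : Message k) : Finset (ℂ × ℂ) :=
  if AngleIntersects m.header.tree m.receiver (m.toAngle G) then
    (angles (G.neighbors m.receiver) m.receiver).filter
      fun q => q ≠ m.toAngle G ∧ AngleIntersects m.header.tree m.receiver q
  else ∅

theorem Message.mem_splitAngles {q : ℂ × ℂ} : q ∈ m.splitAngles G ↔
    AngleIntersects m.header.tree m.receiver (m.toAngle G) ∧
      q ∈ angles (G.neighbors m.receiver) m.receiver ∧ q ≠ m.toAngle G ∧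
        AngleIntersects m.header.tree m.receiver q := by
  unfold Message.splitAngles
  split_ifs <;> simp_all

theorem split_eq_sum : split (G.neighbors m.receiver) m.receiver m.header (m.toAngle G) =
    ∑ q ∈ m.splitAngles G, inject m.header m.receiver q := by
  unfold Message.splitAngles split
  split_ifs <;> simp

/-- A message is forwarded. -/
theorem Invariant.transmit_of_notMem (hG : G.IsPlanar) (hI : Invariant G h σ V Z)
    (hm : Pending G h V Z u m) (hmate : m.mate ∉ σ.queue m.receiver) :
    Invariant G h (transmit G σ u m)
      {x | x ∈ V ∨ x.1 = m.receiver ∧ (x.2 = m.toAngle G ∨ x.2 ∈ m.splitAngles G)}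
      (insert m.dart Z) := by
  obtain ⟨⟨rfl, rfl, hadj⟩, hV, hZ⟩ := id hm
  have hS := hG.distinctRays m.receiver
  have hmem : m.sender ∈ G.neighbors m.receiver := Network.mem_neighbors.2 hadj.symm
  have hAmem : m.toAngle G ∈ angles (G.neighbors m.receiver) m.receiver :=
    hS.passedAngle_mem hmem _
  -- The mate leaves the angle ahead along the same untraversed side. Were this angle visited, the
  -- mate would be pending; so its absence shows that the angle is new.
  have hA : (m.receiver, m.toAngle G) ∉ V := fun hc => hmate <| hI.mem_queue.2
    ⟨⟨rfl, rfl, hadj.symm⟩, by rw [Message.fromAngle_mate]; exact hc, by rwa [m.dart_mate]⟩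
  -- By uniformity the angles that receive pairs are new as well, so no message is duplicated.
  have hN : ∀ q ∈ m.splitAngles G, (m.receiver, q) ∉ V := fun q hq hc => by
    obtain ⟨h1, h2, -, h3⟩ := Message.mem_splitAngles.1 hq
    exact hA (hI.uniform _ q h2 _ hAmem h3 h1 hc)
  have hNA : m.toAngle G ∉ m.splitAngles G := fun hc => (Message.mem_splitAngles.1 hc).2.2.1 rfl
  have hNsub : m.splitAngles G ⊆ angles (G.neighbors m.receiver) m.receiver :=
    fun q hq => (Message.mem_splitAngles.1 hq).2.1
  set f : Message k := ⟨m.dir, m.header, m.receiver,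
    nextHop (G.neighbors m.receiver) m.receiver m.sender m.dir⟩ with hf
  have hfA : f.fromAngle G = m.toAngle G := hS.passedAngle_nextHop hmem m.dir
  have hfadj : G.graph.Adj m.receiver f.receiver :=
    Network.mem_neighbors.1 (nextHop_mem hmem m.dir)
  have hfmate : f ≠ m.mate := fun hc => m.dir.opp_ne (congrArg Message.dir hc).symm
  have hfm : f ≠ m := fun hc => hadj.ne' (congrArg Message.sender hc)
  -- One message per direction leaves the angle ahead: the forwarded one and the mate. The mate does
  -- not become pending, since its side is traversed by this very step.
  have htwo : ∀ m' : Message k, m'.header = m.header → m'.sender = m.receiver →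
      m'.fromAngle G = m.toAngle G → m' = f ∨ m' = m.mate := by
    intro m' h1 h2 h3
    have h4 : m'.dir = f.dir ∨ m'.dir = m.mate.dir := by
      simp only [hf, Message.mate]
      cases m'.dir <;> cases m.dir <;> simp [Direction.opp]
    rcases h4 with h4 | h4
    · exact Or.inl (Message.eq_of_fromAngle h4 h1 h2 (h3.trans hfA.symm))
    · exact Or.inr (Message.eq_of_fromAngle h4 h1 h2 (h3.trans m.fromAngle_mate.symm))
  have hdart : ∀ m' : Message k, m'.header = m.header →
      (m'.dart = m.dart ↔ m' = m ∨ m' = m.mate) := by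
    refine fun m' h1 => ⟨Message.eq_or_eq_mate h1, ?_⟩
    rintro (rfl | rfl)
    · rfl
    · exact m.dart_mate
  refine ⟨fun w m' => ?_, fun m' h1 h2 h3 => ?_, ?_, ?_, fun n p h1 h2 => ?_, fun p h1 h2 =>
    Or.inl (hI.source p h1 h2)⟩
  · simp only [transmit, receive, Function.update_of_ne hadj.ne', if_neg hmate]
    by_cases hw : w = m.receiver
    · subst hw
      rw [Function.update_self, ← Message.toAngle, split_eq_sum, Multiset.count_add,
        Multiset.count_add, count_sum_inject hS hNsub, hI.count_queue, Multiset.count_singleton]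
      by_cases hvalid : m'.header = m.header ∧ m'.sender = m.receiver ∧
          G.graph.Adj m.receiver m'.receiver
      swap
      · have : m' ≠ f := fun hc => hvalid (hc ▸ ⟨rfl, rfl, hfadj⟩)
        simp [Pending, hvalid, this, ← hf]
      have hm' : m' ≠ m := fun hc => hadj.ne (hc ▸ hvalid.2.1)
      have hZ' : m'.dart ∈ Z → (m.receiver, m'.fromAngle G) ∈ V := fun hc => by
        have := hI.fromAngle_mem m' hvalid.1 (hvalid.2.1 ▸ hvalid.2.2) hc
        rwa [hvalid.2.1] at this
      simp only [Pending, hvalid, true_and, Set.mem_ofPred_eq, Finset.mem_insert, not_or,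
        hdart m' hvalid.1, hm', false_or, ← hf]
      by_cases hmm : m' = m.mate
      · subst hmm
        simp [Message.fromAngle_mate, hA, hNA, hfmate.symm]
      by_cases hmf : m' = f
      · subst hmf
        rw [hfA] at hZ' ⊢
        have : f.dart ∉ Z := fun hc => hA (hZ' hc)
        simp [hA, hNA, this, hmm]
      have h5 : m'.fromAngle G ≠ m.toAngle G := fun hc => by
        rcases htwo m' hvalid.1 hvalid.2.1 hc with hc | hc
        · exact hmf hc
        · exact hmm hc
      simp only [hmf, hmm, h5, if_false, add_zero, not_false_eq_true, true_and, false_or]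
      by_cases h6 : m'.fromAngle G ∈ m.splitAngles G
      · have h7 := hN _ h6
        have h8 : m'.dart ∉ Z := fun hc => h7 (hZ' hc)
        simp [h6, h7, h8]
      · simp [h6]
    rw [Function.update_of_ne hw]
    have hiff : Pending G m.header {x | x ∈ V ∨ x.1 = m.receiver ∧
        (x.2 = m.toAngle G ∨ x.2 ∈ m.splitAngles G)} (insert m.dart Z) w m' ↔
        Pending G m.header V Z w m' ∧ m' ≠ m := by
      simp only [Pending, Set.mem_ofPred_eq, hw, false_and, or_false, Finset.mem_insert, not_or]
      constructor
      · rintro ⟨h1, h2, h3, h4⟩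
        exact ⟨⟨h1, h2, h4⟩, fun hc => h3 (hc ▸ rfl)⟩
      · rintro ⟨⟨h1, h2, h4⟩, h3⟩
        refine ⟨h1, h2, fun hc => ?_, h4⟩
        rcases (hdart m' h1.1).1 hc with hc | hc
        · exact h3 hc
        · exact hw (by rw [← h1.2.1, hc]; rfl)
    rw [if_congr hiff rfl rfl]
    by_cases hw' : w = m.sender
    · subst hw'
      rw [Function.update_self, count_erase_ite (hI.count_queue _)]
    · rw [Function.update_of_ne hw', hI.count_queue]
      exact if_congr (iff_self_and.2 fun h1 hc => hw' (hc ▸ h1.1.2.1.symm)) rfl rfl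
  · rcases Finset.mem_insert.1 h3 with h3 | h3
    · rcases Message.eq_or_eq_mate h1 h3 with rfl | rfl
      · exact Or.inl hV
      · exact Or.inr ⟨rfl, Or.inl m.fromAngle_mate⟩
    · exact Or.inl (hI.fromAngle_mem m' h1 h2 h3)
  · exact Finset.insert_subset (Message.dart_mem hadj) hI.subset_darts
  · rintro n p hp q hq hp' hq' (h1 | ⟨rfl, h1⟩)
    · exact Or.inl (hI.uniform n p hp q hq hp' hq' h1)
    · have hgreen : AngleIntersects m.header.tree m.receiver (m.toAngle G) := by
        rcases h1 with h1 | h1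
        · rwa [← h1]
        · exact (Message.mem_splitAngles.1 h1).1
      refine Or.inr ⟨rfl, ?_⟩
      by_cases hqA : q = m.toAngle G
      · exact Or.inl hqA
      · exact Or.inr (Message.mem_splitAngles.2 ⟨hgreen, hq, hqA, hq'⟩)
  · rcases h1 with h1 | ⟨rfl, -⟩
    · exact Or.inl (hI.delivered n p h1 h2)
    · refine Or.inr ⟨rfl, ?_, h2⟩
      rwa [Function.update_of_ne hadj.ne']

/-- A pending message has its side outside `Z`, so `Z` grows by exactly one in either case. -/
theorem Invariant.step (hG : G.IsPlanar) (hI : Invariant G h σ V Z) {σ' : State k}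
    (hstep : Step G σ u m σ') :
    ∃ V' Z', Invariant G h σ' V' Z' ∧ Z'.card = Z.card + 1 := by
  obtain ⟨hm, -, rfl⟩ := hstep
  have hm' := hI.mem_queue.1 hm
  have hcard := Finset.card_insert_of_notMem hm'.2.2
  by_cases hmate : m.mate ∈ σ.queue m.receiver
  · exact ⟨_, _, hI.transmit_of_mem hm' hmate, hcard⟩
  · exact ⟨_, _, hI.transmit_of_notMem hG hm' hmate, hcard⟩

theorem Computation.exists_invariant (hG : G.IsPlanar) (hs : h.source ∉ h.targets)
    (C : Computation G h) (i : ℕ) (hi : (i : ℕ∞) ≤ C.length) :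
    ∃ V Z, Invariant G h (C.state i) V Z ∧ Z.card = i := by
  induction i with
  | zero => exact ⟨_, ∅, C.state_zero ▸ invariant_initial hG hs, rfl⟩
  | succ i ih =>
    have hi' : (i : ℕ∞) < C.length :=
      lt_of_lt_of_le (by exact_mod_cast i.lt_succ_self) hi
    obtain ⟨V, Z, hI, hc⟩ := ih hi'.le
    obtain ⟨u, m, hstep⟩ := C.step i hi'
    obtain ⟨V', Z', hI', hc'⟩ := hI.step hG hstep
    exact ⟨V', Z', hI', by rw [hc', hc]⟩

theorem Computation.isFinite (hG : G.IsPlanar) (hs : h.source ∉ h.targets)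
    (C : Computation G h) : C.IsFinite := by
  intro hc
  obtain ⟨V, Z, hI, hcard⟩ := C.exists_invariant hG hs (G.darts.card + 1) (hc ▸ le_top)
  have := Finset.card_le_card hI.subset_darts
  omega

/-! ### The final state -/

/-- In a state without messages, the visited angles form complete faces. -/
theorem Invariant.isFaceClosed (hG : G.IsPlanar) (hI : Invariant G h σ V Z)
    (hempty : ∀ u m, m ∉ σ.queue u) :
    IsFaceClosed G fun a n => (n, a, nextLeft (G.neighbors n) n a) ∈ V := by
  -- With no pending messages, a side that leaves a visited angle must be in `Z`; then the angle at
  -- its other end is visited too.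
  have key : ∀ m : Message k, m.header = h → G.graph.Adj m.sender m.receiver →
      (m.sender, m.fromAngle G) ∈ V → (m.receiver, m.toAngle G) ∈ V := by
    intro m h1 h2 h3
    have h4 : m.dart ∈ Z := by
      by_contra hc
      exact hempty m.sender m (hI.mem_queue.2 ⟨⟨h1, rfl, h2⟩, h3, hc⟩)
    have h5 := hI.fromAngle_mem m.mate h1 h2.symm (by rwa [m.dart_mate])
    rwa [m.fromAngle_mate] at h5
  intro a n han
  have ha := Network.mem_neighbors.2 han.symm
  have hnb := Network.mem_neighbors.1 (nextLeft_mem (u := n) ha)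
  have hS := hG.distinctRays n
  constructor
  · intro hV
    refine key ⟨.left, h, n, nextLeft (G.neighbors n) n a⟩ rfl hnb ?_
    simpa only [Message.fromAngle, passedAngle, Direction.opp, hS.nextRight_nextLeft ha] using hV
  · intro hV
    have := key ⟨.right, h, nextLeft (G.neighbors n) n a, n⟩ rfl hnb.symm hV
    simpa only [Message.toAngle, passedAngle, hS.nextRight_nextLeft ha] using this

/-- The two angles at `x` that share the edge `xy` both intersect the tree, so they are visited
together. Face closure identifies the one before `y` with the angle at `y` on the same side of the
edge. -/
theorem Invariant.boundary_disjoint (hG : G.IsPlanar) (hI : Invariant G h σ V Z)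
    (hempty : ∀ u m, m ∉ σ.queue u) {x y : ℂ} (hxy : G.graph.Adj x y)
    (hT : (segment ℝ x y ∩ h.tree.carrier).Nonempty) :
    (y, x, nextLeft (G.neighbors y) y x) ∈ V ↔ (x, y, nextLeft (G.neighbors x) x y) ∈ V := by
  have hy := Network.mem_neighbors.2 hxy
  have hS := hG.distinctRays x
  have hF := (hI.isFaceClosed hG hempty).nextRight hG hxy
  simp only [hS.nextLeft_nextRight hy] at hF
  have h1 : passedAngle (G.neighbors x) x y .left ∈ angles (G.neighbors x) x :=
    hS.passedAngle_mem hy _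
  have h2 : passedAngle (G.neighbors x) x y .right ∈ angles (G.neighbors x) x :=
    hS.passedAngle_mem hy _
  rw [← hF]
  exact ⟨hI.uniform x _ h2 _ h1 (Or.inr hT) (Or.inl hT),
    hI.uniform x _ h1 _ h2 (Or.inl hT) (Or.inr hT)⟩

/-- A message left in the last state would, by fairness, require a further step. -/
theorem Computation.exists_final {C : Computation G h} (hfin : C.IsFinite) (hC : C.IsFair) :
    ∃ L : ℕ, (L : ℕ∞) = C.length ∧ ∀ u m, m ∉ (C.state L).queue u := by
  obtain ⟨L, hL⟩ := ENat.ne_top_iff_exists.1 hfin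
  refine ⟨L, hL, fun u m hm => ?_⟩
  obtain ⟨j, h1, h2, -⟩ := hC L u m hL.le hm
  rw [← hL] at h2
  exact absurd (by exact_mod_cast h2 : j < L) (not_lt.2 h1)

theorem Computation.deliversTo (hG : G.IsPlanar) (hs : h.source ∉ h.targets)
    (hT : h.tree.Connects (insert h.source h.targets)) {C : Computation G h} (hC : C.IsFair)
    {t : ℂ} (ht : t ∈ h.targets) (hreach : G.graph.Reachable h.source t) : C.DeliversTo t := by
  obtain ⟨L, hL, hempty⟩ := Computation.exists_final (C.isFinite hG hs) hC
  obtain ⟨V, Z, hI, -⟩ := C.exists_invariant hG hs L hL.le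
  obtain ⟨i, hi⟩ := hT.2 h.source (Finset.mem_insert_self _ _)
  obtain ⟨j, hj⟩ := hT.2 t (Finset.mem_insert_of_mem ht)
  have hne : h.source ≠ t := fun hc => hs (hc ▸ ht)
  obtain ⟨b, -, hb⟩ := exists_dart_of_reachable hG (hI.isFaceClosed hG hempty) hT.1
    (fun x y hxy hxyT => hI.boundary_disjoint hG hempty hxy hxyT) (i := i) (j := j)
    (by rwa [hi, hj]) (by rwa [hi, hj]) (by
      rw [hi]
      intro b hb
      -- The source is a vertex of the tree and an endpoint of its own edges, so every angle there
      -- intersects the tree and is visited from the start.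
      refine hI.source _
        ((hG.distinctRays _).passedAngle_mem (Network.mem_neighbors.2 hb) .left)
        (Or.inl ⟨h.source, left_mem_segment ℝ _ _, Or.inl ⟨i, hi.symm⟩⟩))
  rw [hj] at hb
  exact ⟨L, hL.le, hI.delivered t _ hb ht⟩

end

end MCFR

theorem mainTheorem1 (G : MCFR.Network) (hG : G.IsPlanar)
    (s : ℂ) (hs : s ∈ G.nodes)
    (targets : Finset ℂ) (htargets : targets ⊆ G.nodes) (hst : s ∉ targets)
    {k : ℕ} (T : MCFR.PlaneGraph k) (hT : T.IsSteinerTree (insert s targets))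
    (C : MCFR.Computation G (MCFR.Header.mk s targets T)) (hC : C.IsFair) :
    C.IsFinite ∧ ∀ t ∈ targets, G.graph.Reachable s t → C.DeliversTo t :=
  ⟨C.isFinite hG hst, fun _ ht hreach =>
    MCFR.Computation.deliversTo hG hst hT.2.1 hC ht hreach⟩
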